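/- Manifolds (finite-dimensional, without boundary), metrics and maps are smooth. For a map $f:(M,g)\to(N,h)$ between Riemannian manifolds, let $\nabla^f$ be the connection induced on $f^{-1}TN$ by the Levi-Civita connection of $h$, let $$\tau(f)=\operatorname{Trace}_g\nabla\,\mathrm{d}f=\sum_i\bigl\{\nabla^f_{e_i}\mathrm{d}f(e_i)-\mathrm{d}f(\nabla^M_{e_i}e_i)\bigr\}$$ be its tension field, and let $$\tau^2(f)=\operatorname{Trace}_g\bigl(\nabla^f\nabla^f-\nabla^f_{\nabla^M}\bigr)\tau(f)-\operatorname{Trace}_g R^N(\mathrm{d}f,\tau(f))\,\mathrm{d}f$$ be its bitension field, where $(e_i)$ is a local orthonormal frame and $R^N(X,Y)Z=[\nabla^N_X,\nabla^N_Y]Z-\nabla^N_{[X,Y]}Z$. The map $f$ is harmonic if $\tau(f)\equiv 0$, biharmonic if $\tau^2(f)\equiv 0$ (the Euler–Lagrange equation of the bienergy $\frac12\int|\tau(f)|^2$), and proper biharmonic if it is biharmonic but not harmonic. **Theorem.** Let $\varphi:(M,g)\to(N_1,h_1)$ and $\psi:(M,g)\to(N_2,h_2)$ be two maps between Riemannian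 manifolds. Then the map $\phi:(M,g)\to(N_1\times N_2,h_1\times h_2)$, $\phi(x)=(\varphi(x),\psi(x))$, into the Riemannian product is biharmonic if and only if both $\varphi$ and $\psi$ are biharmonic. Furthermore, if one of $\varphi$ and $\psi$ is harmonic and the other is proper biharmonic, then $\phi$ is proper biharmonic. -/

import Mathlib

open scoped Manifold ContDiff Topology
open Bundle

noncomputable section

namespace BiharmonicMaps

/-! ## Bilinear forms -/

/-- The pullback `(u, v) ↦ B (A u) (A v)` of a bilinear form along a linear map. -/
def pullbackForm {V W : Type*}
    [AddCommGroup V] [Module ℝ V] [TopologicalSpace V] [IsTopologicalAddGroup V]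
    [ContinuousSMul ℝ V]
    [AddCommGroup W] [Module ℝ W] [TopologicalSpace W] [IsTopologicalAddGroup W]
    [ContinuousSMul ℝ W]
    (B : V →L[ℝ] V →L[ℝ] ℝ) (A : W →L[ℝ] V) : W →L[ℝ] W →L[ℝ] ℝ :=
  (ContinuousLinearMap.precomp ℝ A).comp (B.comp A)

theorem pullbackForm_apply {V W : Type*}
    [AddCommGroup V] [Module ℝ V] [TopologicalSpace V] [IsTopologicalAddGroup V]
    [ContinuousSMul ℝ V]
    [AddCommGroup W] [Module ℝ W] [TopologicalSpace W] [IsTopologicalAddGroup W]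
    [ContinuousSMul ℝ W]
    (B : V →L[ℝ] V →L[ℝ] ℝ) (A : W →L[ℝ] V) (u v : W) :
    pullbackForm B A u v = B (A u) (A v) := rfl

theorem contMDiff_pullbackForm {V W : Type*} [NormedAddCommGroup V] [NormedSpace ℝ V]
    [NormedAddCommGroup W] [NormedSpace ℝ W] (A : W →L[ℝ] V) :
    ContMDiff 𝓘(ℝ, V →L[ℝ] V →L[ℝ] ℝ) 𝓘(ℝ, W →L[ℝ] W →L[ℝ] ℝ) ∞
      (fun B : V →L[ℝ] V →L[ℝ] ℝ ↦ pullbackForm B A) := by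
  have h : ContDiff ℝ ∞ (fun B : V →L[ℝ] V →L[ℝ] ℝ ↦ pullbackForm B A) := by
    unfold pullbackForm
    fun_prop
  exact h.contMDiff

/-- A bilinear form on a tangent space, read in the trivialization given by the chart at `x₀`. -/
theorem trivializationAt_form_apply
    {E : Type*} [NormedAddCommGroup E] [NormedSpace ℝ E]
    {H : Type*} [TopologicalSpace H] {I : ModelWithCorners ℝ E H}
    {M : Type*} [TopologicalSpace M] [ChartedSpace H M] [IsManifold I ∞ M]
    (x₀ x : M) (hx : x ∈ (chartAt H x₀).source)
    (B : TangentSpace I x →L[ℝ] TangentSpace I x →L[ℝ] ℝ) (u v : E) :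
    (trivializationAt (E →L[ℝ] E →L[ℝ] ℝ)
      (fun y : M ↦ TangentSpace I y →L[ℝ] TangentSpace I y →L[ℝ] ℝ) x₀ ⟨x, B⟩).2 u v =
    B (mfderivWithin 𝓘(ℝ, E) I (extChartAt I x₀).symm (Set.range I) (extChartAt I x₀ x) u)
      (mfderivWithin 𝓘(ℝ, E) I (extChartAt I x₀).symm (Set.range I) (extChartAt I x₀ x) v) := by
  rw [← TangentBundle.symmL_trivializationAt hx]
  have hb : x ∈ (trivializationAt E (TangentSpace I : M → Type _) x₀).baseSet := hx
  simp [hom_trivializationAt_apply, ContinuousLinearMap.inCoordinates, hx]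
  rfl

theorem inner_self_nonneg
    {E : Type*} [NormedAddCommGroup E] [NormedSpace ℝ E]
    {H : Type*} [TopologicalSpace H] {I : ModelWithCorners ℝ E H}
    {M : Type*} [TopologicalSpace M] [ChartedSpace H M] [IsManifold I ∞ M]
    (g : ContMDiffRiemannianMetric I ∞ E (TangentSpace I : M → Type _)) (x : M)
    (v : TangentSpace I x) : 0 ≤ g.inner x v v := by
  by_cases h : v = 0
  · rw [h]; simp
  · exact (g.pos x v h).le

/-! ## The Riemannian product of two Riemannian manifolds -/

section ProductMetric

variable
  {F₁ : Type*} [NormedAddCommGroup F₁] [NormedSpace ℝ F₁]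
  {H₁ : Type*} [TopologicalSpace H₁] {J₁ : ModelWithCorners ℝ F₁ H₁}
  {N₁ : Type*} [TopologicalSpace N₁] [ChartedSpace H₁ N₁] [IsManifold J₁ ∞ N₁]
  {F₂ : Type*} [NormedAddCommGroup F₂] [NormedSpace ℝ F₂]
  {H₂ : Type*} [TopologicalSpace H₂] {J₂ : ModelWithCorners ℝ F₂ H₂}
  {N₂ : Type*} [TopologicalSpace N₂] [ChartedSpace H₂ N₂] [IsManifold J₂ ∞ N₂]

/-- The product tensor `π₁^* h₁ + π₂^* h₂` on `N₁ × N₂`. -/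
def prodInner
    (h₁ : ContMDiffRiemannianMetric J₁ ∞ F₁ (TangentSpace J₁ : N₁ → Type _))
    (h₂ : ContMDiffRiemannianMetric J₂ ∞ F₂ (TangentSpace J₂ : N₂ → Type _)) (p : N₁ × N₂) :
    TangentSpace (J₁.prod J₂) p →L[ℝ] TangentSpace (J₁.prod J₂) p →L[ℝ] ℝ :=
  pullbackForm (h₁.inner p.1) (mfderiv (J₁.prod J₂) J₁ Prod.fst p) +
    pullbackForm (h₂.inner p.2) (mfderiv (J₁.prod J₂) J₂ Prod.snd p)

theorem prodInner_apply
    (h₁ : ContMDiffRiemannianMetric J₁ ∞ F₁ (TangentSpace J₁ : N₁ → Type _))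
    (h₂ : ContMDiffRiemannianMetric J₂ ∞ F₂ (TangentSpace J₂ : N₂ → Type _)) (p : N₁ × N₂)
    (u v : F₁ × F₂) :
    prodInner h₁ h₂ p u v = h₁.inner p.1 u.1 v.1 + h₂.inner p.2 u.2 v.2 := by
  have e1 : mfderiv (J₁.prod J₂) J₁ Prod.fst p = ContinuousLinearMap.fst ℝ F₁ F₂ := mfderiv_fst
  have e2 : mfderiv (J₁.prod J₂) J₂ Prod.snd p = ContinuousLinearMap.snd ℝ F₁ F₂ := mfderiv_snd
  change h₁.inner p.1 (mfderiv (J₁.prod J₂) J₁ Prod.fst p u)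
      (mfderiv (J₁.prod J₂) J₁ Prod.fst p v) +
    h₂.inner p.2 (mfderiv (J₁.prod J₂) J₂ Prod.snd p u)
      (mfderiv (J₁.prod J₂) J₂ Prod.snd p v) = _
  rw [e1, e2]
  rfl

theorem contMDiff_prodInner
    (h₁ : ContMDiffRiemannianMetric J₁ ∞ F₁ (TangentSpace J₁ : N₁ → Type _))
    (h₂ : ContMDiffRiemannianMetric J₂ ∞ F₂ (TangentSpace J₂ : N₂ → Type _)) :
    ContMDiff (J₁.prod J₂) ((J₁.prod J₂).prod 𝓘(ℝ, (F₁ × F₂) →L[ℝ] (F₁ × F₂) →L[ℝ] ℝ)) ∞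
      (fun p : N₁ × N₂ ↦ TotalSpace.mk' ((F₁ × F₂) →L[ℝ] (F₁ × F₂) →L[ℝ] ℝ)
        (E := fun p : N₁ × N₂ ↦
          TangentSpace (J₁.prod J₂) p →L[ℝ] TangentSpace (J₁.prod J₂) p →L[ℝ] ℝ)
        p (prodInner h₁ h₂ p)) := by
  intro p₀
  rw [contMDiffAt_section]
  have c1 := (contMDiffAt_section p₀.1).1 (h₁.contMDiff p₀.1)
  have c2 := (contMDiffAt_section p₀.2).1 (h₂.contMDiff p₀.2)
  have k1 : ContMDiffAt (J₁.prod J₂) 𝓘(ℝ, (F₁ × F₂) →L[ℝ] (F₁ × F₂) →L[ℝ] ℝ) ∞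
      (fun p : N₁ × N₂ ↦ pullbackForm
        (trivializationAt (F₁ →L[ℝ] F₁ →L[ℝ] ℝ)
          (fun y : N₁ ↦ TangentSpace J₁ y →L[ℝ] TangentSpace J₁ y →L[ℝ] ℝ) p₀.1
            ⟨p.1, h₁.inner p.1⟩).2 (ContinuousLinearMap.fst ℝ F₁ F₂)) p₀ := by
    have hc := ContMDiffAt.comp p₀ (g := fun x : N₁ ↦ (trivializationAt (F₁ →L[ℝ] F₁ →L[ℝ] ℝ)
          (fun y : N₁ ↦ TangentSpace J₁ y →L[ℝ] TangentSpace J₁ y →L[ℝ] ℝ) p₀.1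
            ⟨x, h₁.inner x⟩).2) c1 (contMDiffAt_fst (I := J₁) (J := J₂) (p := p₀))
    exact ((contMDiff_pullbackForm (ContinuousLinearMap.fst ℝ F₁ F₂)).contMDiffAt).comp p₀ hc
  have k2 : ContMDiffAt (J₁.prod J₂) 𝓘(ℝ, (F₁ × F₂) →L[ℝ] (F₁ × F₂) →L[ℝ] ℝ) ∞
      (fun p : N₁ × N₂ ↦ pullbackForm
        (trivializationAt (F₂ →L[ℝ] F₂ →L[ℝ] ℝ)
          (fun y : N₂ ↦ TangentSpace J₂ y →L[ℝ] TangentSpace J₂ y →L[ℝ] ℝ) p₀.2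
            ⟨p.2, h₂.inner p.2⟩).2 (ContinuousLinearMap.snd ℝ F₁ F₂)) p₀ := by
    have hc := ContMDiffAt.comp p₀ (g := fun x : N₂ ↦ (trivializationAt (F₂ →L[ℝ] F₂ →L[ℝ] ℝ)
          (fun y : N₂ ↦ TangentSpace J₂ y →L[ℝ] TangentSpace J₂ y →L[ℝ] ℝ) p₀.2
            ⟨x, h₂.inner x⟩).2) c2 (contMDiffAt_snd (I := J₁) (J := J₂) (p := p₀))
    exact ((contMDiff_pullbackForm (ContinuousLinearMap.snd ℝ F₁ F₂)).contMDiffAt).comp p₀ hc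
  refine (k1.add k2).congr_of_eventuallyEq ?_
  filter_upwards [(chartAt (ModelProd H₁ H₂) p₀).open_source.mem_nhds
    (mem_chart_source (ModelProd H₁ H₂) p₀)] with p hp
  have hp1 : p.1 ∈ (chartAt H₁ p₀.1).source := by
    rw [prodChartedSpace_chartAt] at hp
    exact hp.1
  have hp2 : p.2 ∈ (chartAt H₂ p₀.2).source := by
    rw [prodChartedSpace_chartAt] at hp
    exact hp.2
  refine ContinuousLinearMap.ext fun u ↦ ContinuousLinearMap.ext fun v ↦ ?_
  have hD (w : F₁ × F₂) :
      mfderivWithin 𝓘(ℝ, F₁ × F₂) (J₁.prod J₂) (extChartAt (J₁.prod J₂) p₀).symm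
        (Set.range (J₁.prod J₂)) (extChartAt (J₁.prod J₂) p₀ p) w =
      ((mfderivWithin 𝓘(ℝ, F₁) J₁ (extChartAt J₁ p₀.1).symm (Set.range J₁)
          (extChartAt J₁ p₀.1 p.1) w.1,
        mfderivWithin 𝓘(ℝ, F₂) J₂ (extChartAt J₂ p₀.2).symm (Set.range J₂)
          (extChartAt J₂ p₀.2 p.2) w.2) : F₁ × F₂) := by
    have m1 := mdifferentiableWithinAt_extChartAt_symm (I := J₁) (x := p₀.1)
      (z := extChartAt J₁ p₀.1 p.1) ((extChartAt J₁ p₀.1).map_source (by simpa using hp1))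
    have m2 := mdifferentiableWithinAt_extChartAt_symm (I := J₂) (x := p₀.2)
      (z := extChartAt J₂ p₀.2 p.2) ((extChartAt J₂ p₀.2).map_source (by simpa using hp2))
    have u1 : UniqueMDiffWithinAt 𝓘(ℝ, F₁) (Set.range J₁) (extChartAt J₁ p₀.1 p.1) :=
      (J₁.uniqueDiffOn _ (by simp [extChartAt])).uniqueMDiffWithinAt
    have u2 : UniqueMDiffWithinAt 𝓘(ℝ, F₂) (Set.range J₂) (extChartAt J₂ p₀.2 p.2) :=
      (J₂.uniqueDiffOn _ (by simp [extChartAt])).uniqueMDiffWithinAt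
    have key := mfderivWithin_prodMap
      (p := (extChartAt J₁ p₀.1 p.1, extChartAt J₂ p₀.2 p.2)) m1 m2 u1 u2
    have hr : Set.range (J₁.prod J₂) = Set.range J₁ ×ˢ Set.range J₂ := by
      rw [← Set.range_prodMap]; rfl
    have he : ((extChartAt (J₁.prod J₂) p₀).symm : F₁ × F₂ → N₁ × N₂) =
        Prod.map (extChartAt J₁ p₀.1).symm (extChartAt J₂ p₀.2).symm := by
      rw [extChartAt_prod]; rfl
    have hx : extChartAt (J₁.prod J₂) p₀ p =
        (extChartAt J₁ p₀.1 p.1, extChartAt J₂ p₀.2 p.2) := by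
      rw [extChartAt_prod]; rfl
    rw [hr, he, hx]
    rw [← modelWithCornersSelf_prod, chartedSpaceSelf_prod] at key
    exact DFunLike.congr_fun key w
  rw [trivializationAt_form_apply p₀ p hp, hD, hD]
  refine (prodInner_apply h₁ h₂ p _ _).trans ?_
  change _ = pullbackForm _ _ u v + pullbackForm _ _ u v
  rw [pullbackForm_apply, pullbackForm_apply,
    trivializationAt_form_apply p₀.1 p.1 hp1, trivializationAt_form_apply p₀.2 p.2 hp2]
  rfl

/-- The Riemannian product metric `h₁ × h₂` on `N₁ × N₂`. -/
def prodMetric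
    (h₁ : ContMDiffRiemannianMetric J₁ ∞ F₁ (TangentSpace J₁ : N₁ → Type _))
    (h₂ : ContMDiffRiemannianMetric J₂ ∞ F₂ (TangentSpace J₂ : N₂ → Type _)) :
    ContMDiffRiemannianMetric (J₁.prod J₂) ∞ (F₁ × F₂)
      (TangentSpace (J₁.prod J₂) : N₁ × N₂ → Type _) where
  inner p := prodInner h₁ h₂ p
  symm p v w := by
    have a := prodInner_apply h₁ h₂ p v w
    have b := prodInner_apply h₁ h₂ p w v
    have c := h₁.symm p.1 (Prod.fst v) (Prod.fst w)
    have d := h₂.symm p.2 (Prod.snd v) (Prod.snd w)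
    exact a.trans ((congrArg₂ (· + ·) c d).trans b.symm)
  pos p v hv := by
    have a := prodInner_apply h₁ h₂ p v v
    have n1 : 0 ≤ h₁.inner p.1 (Prod.fst v) (Prod.fst v) := inner_self_nonneg h₁ p.1 _
    have n2 : 0 ≤ h₂.inner p.2 (Prod.snd v) (Prod.snd v) := by
      by_cases h : (Prod.snd v : TangentSpace J₂ p.2) = 0
      · rw [h]; simp
      · exact (h₂.pos p.2 _ h).le
    refine lt_of_lt_of_eq ?_ a.symm
    by_cases h : (Prod.fst v : TangentSpace J₁ p.1) = 0
    · have h' : (Prod.snd v : TangentSpace J₂ p.2) ≠ 0 := fun h' ↦ hv (Prod.ext h h')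
      exact add_pos_of_nonneg_of_pos n1 (h₂.pos p.2 _ h')
    · exact add_pos_of_pos_of_nonneg (h₁.pos p.1 _ h) n2
  isVonNBounded p := by
    have b1 : Bornology.IsVonNBounded ℝ {v : F₁ | h₁.inner p.1 v v < 1} := h₁.isVonNBounded p.1
    have b2 : Bornology.IsVonNBounded ℝ {v : F₂ | h₂.inner p.2 v v < 1} := h₂.isVonNBounded p.2
    rw [NormedSpace.isVonNBounded_iff] at b1 b2
    have b3 := (NormedSpace.isVonNBounded_iff ℝ (E := F₁ × F₂)).2 (b1.prod b2)
    refine Bornology.IsVonNBounded.subset ?_ b3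
    intro v hv
    have a := prodInner_apply h₁ h₂ p v v
    have hv' : h₁.inner p.1 (Prod.fst v) (Prod.fst v) +
        h₂.inner p.2 (Prod.snd v) (Prod.snd v) < 1 := lt_of_eq_of_lt a.symm hv
    have n1 : 0 ≤ h₁.inner p.1 (Prod.fst v) (Prod.fst v) := inner_self_nonneg h₁ p.1 _
    have n2 : 0 ≤ h₂.inner p.2 (Prod.snd v) (Prod.snd v) := inner_self_nonneg h₂ p.2 _
    exact ⟨by change h₁.inner p.1 (Prod.fst v) (Prod.fst v) < 1; linarith,
      by change h₂.inner p.2 (Prod.snd v) (Prod.snd v) < 1; linarith⟩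
  contMDiff := contMDiff_prodInner h₁ h₂

end ProductMetric

/-! ## Riemannian calculus in coordinates

Below `G` is a Riemannian metric on (an open subset of) `E`, `K` is a Riemannian metric on (an open
subset of) `F`, and `f` is a map from the first to the second. A vector `u` also stands for the
constant (coordinate) vector field with value `u`, so that Lie brackets of such fields vanish. -/

section Local

variable {E : Type*} [NormedAddCommGroup E] [NormedSpace ℝ E]
  {F : Type*} [NormedAddCommGroup F] [NormedSpace ℝ F]

/-- The Levi-Civita connection in coordinates: `christoffel G x u v` is the value at `x` of `∇_u v`
for the constant fields `u`, `v`. It is the vector `w` with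
`2 G(w, z) = (D_u G)(v, z) + (D_v G)(u, z) - (D_z G)(u, v)` for all `z`, that is,
`w^k = Γ^k_{ij} u^i v^j`. -/
def christoffel (G : E → E →L[ℝ] E →L[ℝ] ℝ) (x u v : E) : E :=
  (G x).inverse ((1 / 2 : ℝ) •
    (fderiv ℝ G x u v + fderiv ℝ G x v u - ((fderiv ℝ G x).flip u).flip v))

/-- The Riemann curvature `R(X, Y)Z = ∇_X ∇_Y Z - ∇_Y ∇_X Z - ∇_{[X, Y]} Z` at `x`, computed with
constant fields. -/
def curvature (G : E → E →L[ℝ] E →L[ℝ] ℝ) (x X Y Z : E) : E :=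
  (fderiv ℝ (fun y ↦ christoffel G y Y Z) x X + christoffel G x X (christoffel G x Y Z)) -
    (fderiv ℝ (fun y ↦ christoffel G y X Z) x Y + christoffel G x Y (christoffel G x X Z))

/-- The trace `∑_{i,j} g^{ij} T(b_i, b_j) = ∑_i T(b_i, (b^i)^♯)` of a bilinear map `T` with respect
to an inner product `g`, where `(b_i)` is a basis, `(b^i)` its dual basis, and `♯` is the inverse of
`v ↦ g(v, ·)`. It equals `∑_i T(e_i, e_i)` for every `g`-orthonormal basis `(e_i)`. -/
def metricTrace [FiniteDimensional ℝ E] (g : E →L[ℝ] E →L[ℝ] ℝ) (T : E → E → F) : F :=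
  ∑ i, T (Module.finBasis ℝ E i)
    (g.inverse (LinearMap.toContinuousLinearMap ((Module.finBasis ℝ E).coord i)))

/-- The pullback connection: `∇^f_u V` at `x`, for a vector field `V` along `f`. -/
def covDerivAlong (K : F → F →L[ℝ] F →L[ℝ] ℝ) (f : E → F) (V : E → F) (x u : E) : F :=
  fderiv ℝ V x u + christoffel K (f x) (fderiv ℝ f x u) (V x)

/-- The tension field `τ(f) = Trace_G ∇df`, where `∇df(u, v) = ∇^f_u (df v) - df (∇_u v)`. -/
def localTension [FiniteDimensional ℝ E]
    (G : E → E →L[ℝ] E →L[ℝ] ℝ) (K : F → F →L[ℝ] F →L[ℝ] ℝ) (f : E → F) (x : E) : F :=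
  metricTrace (G x) fun u v ↦
    covDerivAlong K f (fun y ↦ fderiv ℝ f y v) x u - fderiv ℝ f x (christoffel G x u v)

/-- The bitension field
`τ²(f) = Trace_G (∇^f ∇^f - ∇^f_∇) τ(f) - Trace_G R(df, τ(f)) df`. -/
def localBitension [FiniteDimensional ℝ E]
    (G : E → E →L[ℝ] E →L[ℝ] ℝ) (K : F → F →L[ℝ] F →L[ℝ] ℝ) (f : E → F) (x : E) : F :=
  metricTrace (G x) (fun u v ↦
    covDerivAlong K f (fun y ↦ covDerivAlong K f (localTension G K f) y v) x u -
      covDerivAlong K f (localTension G K f) x (christoffel G x u v)) -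
  metricTrace (G x) (fun u v ↦
    curvature K (f x) (fderiv ℝ f x u) (localTension G K f x) (fderiv ℝ f x v))

end Local

/-! ## Harmonic and biharmonic maps between Riemannian manifolds -/

section Manifold

variable
  {E : Type*} [NormedAddCommGroup E] [NormedSpace ℝ E]
  {H : Type*} [TopologicalSpace H] {I : ModelWithCorners ℝ E H}
  {M : Type*} [TopologicalSpace M] [ChartedSpace H M] [IsManifold I ∞ M]
  {F : Type*} [NormedAddCommGroup F] [NormedSpace ℝ F]
  {H' : Type*} [TopologicalSpace H'] {J : ModelWithCorners ℝ F H'}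
  {N : Type*} [TopologicalSpace N] [ChartedSpace H' N] [IsManifold J ∞ N]

/-- The metric `g` in the chart around `x₀`: the pullback of `g` by the inverse of the chart. -/
def chartMetric (g : ContMDiffRiemannianMetric I ∞ E (TangentSpace I : M → Type _)) (x₀ : M) :
    E → E →L[ℝ] E →L[ℝ] ℝ := fun y ↦
  pullbackForm (W := E) (g.inner ((extChartAt I x₀).symm y))
    (mfderivWithin 𝓘(ℝ, E) I (extChartAt I x₀).symm (Set.range I) y)

/-- The tension field of `φ` in the charts around `x₀` and `φ x₀`. -/
def tensionInChart [FiniteDimensional ℝ E]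
    (g : ContMDiffRiemannianMetric I ∞ E (TangentSpace I : M → Type _))
    (h : ContMDiffRiemannianMetric J ∞ F (TangentSpace J : N → Type _)) (φ : M → N) (x₀ : M) :
    E → F :=
  localTension (chartMetric g x₀) (chartMetric h (φ x₀)) (writtenInExtChartAt I J x₀ φ)

/-- The bitension field of `φ` in the charts around `x₀` and `φ x₀`. -/
def bitensionInChart [FiniteDimensional ℝ E]
    (g : ContMDiffRiemannianMetric I ∞ E (TangentSpace I : M → Type _))
    (h : ContMDiffRiemannianMetric J ∞ F (TangentSpace J : N → Type _)) (φ : M → N) (x₀ : M) :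
    E → F :=
  localBitension (chartMetric g x₀) (chartMetric h (φ x₀)) (writtenInExtChartAt I J x₀ φ)

/-- `φ` is harmonic: its tension field vanishes identically, i.e. in charts near every point. -/
def IsHarmonic [FiniteDimensional ℝ E]
    (g : ContMDiffRiemannianMetric I ∞ E (TangentSpace I : M → Type _))
    (h : ContMDiffRiemannianMetric J ∞ F (TangentSpace J : N → Type _)) (φ : M → N) : Prop :=
  ∀ x₀ : M, ∀ᶠ y in 𝓝 (extChartAt I x₀ x₀), tensionInChart g h φ x₀ y = 0

/-- `φ` is biharmonic: its bitension field vanishes identically, i.e. in charts near every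
point. -/
def IsBiharmonic [FiniteDimensional ℝ E]
    (g : ContMDiffRiemannianMetric I ∞ E (TangentSpace I : M → Type _))
    (h : ContMDiffRiemannianMetric J ∞ F (TangentSpace J : N → Type _)) (φ : M → N) : Prop :=
  ∀ x₀ : M, ∀ᶠ y in 𝓝 (extChartAt I x₀ x₀), bitensionInChart g h φ x₀ y = 0

/-- A proper biharmonic map is a biharmonic map that is not harmonic. -/
def IsProperBiharmonic [FiniteDimensional ℝ E]
    (g : ContMDiffRiemannianMetric I ∞ E (TangentSpace I : M → Type _))
    (h : ContMDiffRiemannianMetric J ∞ F (TangentSpace J : N → Type _)) (φ : M → N) : Prop :=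
  IsBiharmonic g h φ ∧ ¬ IsHarmonic g h φ

end Manifold

end BiharmonicMaps

end

/-! In product charts the metric `prodMetric h₁ h₂` is block diagonal, and each block depends only
on its own variable. Koszul's formula therefore splits its Christoffel symbols (`christoffel_prod`),
so each of the two linear projections `P` out of `F₁ × F₂` intertwines the Christoffel symbols of
the product with those of the factor. Tension and bitension are built from the metric of the domain,
derivatives of the map, and the Christoffel symbols of the target with their derivatives. A linear
intertwining `P` commutes with all of these operations (`map_localTension`, `map_localBitension`).
Hence both fields of `x ↦ (φ x, ψ x)` are the pairs of the fields of `φ` and `ψ`, and a pair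
vanishes exactly when both entries do. For proper biharmonicity, every term of the bitension
contains the tension or its covariant derivatives, so a harmonic factor is biharmonic
(`localBitension_eq_zero`). The splitting of the tension shows that one non-harmonic factor makes
the pair non-harmonic. Since `fderiv` and `ContinuousLinearMap.inverse` return zero where no
derivative or inverse exists, the commutation needs actual regularity: chart metrics are smooth and
invertible on chart targets (`contDiffAt_chartMetric`, `isInvertible_chartMetric`), and the tension
inherits smoothness from them. -/

noncomputable section

namespace BiharmonicMaps

section LocalCalculus

variable {E : Type*} [NormedAddCommGroup E] [NormedSpace ℝ E]
  {F : Type*} [NormedAddCommGroup F] [NormedSpace ℝ F]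
  {F' : Type*} [NormedAddCommGroup F'] [NormedSpace ℝ F']

/-- Shortcut instance for spaces of bilinear maps. -/
local instance normedAddCommGroupBilinear {V W X : Type*} [NormedAddCommGroup V]
    [NormedSpace ℝ V] [NormedAddCommGroup W] [NormedSpace ℝ W] [NormedAddCommGroup X]
    [NormedSpace ℝ X] : NormedAddCommGroup (V →L[ℝ] W →L[ℝ] X) :=
  ContinuousLinearMap.toNormedAddCommGroup

/-- Shortcut instance for spaces of bilinear maps. -/
local instance normedSpaceBilinear {V W X : Type*} [NormedAddCommGroup V]
    [NormedSpace ℝ V] [NormedAddCommGroup W] [NormedSpace ℝ W] [NormedAddCommGroup X]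
    [NormedSpace ℝ X] : NormedSpace ℝ (V →L[ℝ] W →L[ℝ] X) :=
  ContinuousLinearMap.toNormedSpace

/-! ## Smoothness of the local expressions -/

theorem contDiffAt_inverse_of_isInvertible [CompleteSpace F] {A : F →L[ℝ] F'}
    (hA : A.IsInvertible) : ContDiffAt ℝ ∞ ContinuousLinearMap.inverse A := by
  obtain ⟨e, rfl⟩ := hA
  exact contDiffAt_map_inverse e

theorem contDiffAt_comp_apply {V W X : Type*} [NormedAddCommGroup V] [NormedSpace ℝ V]
    [NormedAddCommGroup W] [NormedSpace ℝ W] [NormedAddCommGroup X] [NormedSpace ℝ X]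
    (L : V →L[ℝ] X →L[ℝ] W) {A : E → F →L[ℝ] X} {b : E → V} {x : E}
    (hA : ContDiffAt ℝ ∞ A x) (hb : ContDiffAt ℝ ∞ b x) :
    ContDiffAt ℝ ∞ (fun y ↦ (L (b y)).comp (A y)) x :=
  (ContDiffAt.comp x L.contDiff.contDiffAt hb).clm_comp hA

/-- Flipping and evaluating at `b y` is post-composition with the evaluation map at `b y`, which
depends linearly on `b y`. Used twice, this handles the term `z ↦ (D_z K)(u, v)` of Koszul's
formula. -/
theorem contDiffAt_flip_apply {V W : Type*} [NormedAddCommGroup V] [NormedSpace ℝ V]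
    [NormedAddCommGroup W] [NormedSpace ℝ W] {A : E → F →L[ℝ] V →L[ℝ] W} {b : E → V} {x : E}
    (hA : ContDiffAt ℝ ∞ A x) (hb : ContDiffAt ℝ ∞ b x) :
    ContDiffAt ℝ ∞ (fun y ↦ (A y).flip (b y)) x := by
  have h := contDiffAt_comp_apply (X := V →L[ℝ] W) (ContinuousLinearMap.apply ℝ W (E := V)) hA hb
  exact h

theorem contDiffAt_fderiv_comp {V : Type*} [NormedAddCommGroup V] [NormedSpace ℝ V]
    {K : F → V} {a : E → F} {x : E} (hK : ContDiffAt ℝ ∞ K (a x)) (ha : ContDiffAt ℝ ∞ a x) :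
    ContDiffAt ℝ ∞ (fun y ↦ fderiv ℝ K (a y)) x :=
  ContDiffAt.comp x (hK.fderiv_right (m := ∞) le_rfl) ha

theorem contDiffAt_christoffel [CompleteSpace F] {K : F → F →L[ℝ] F →L[ℝ] ℝ}
    {a b c : E → F} {x : E} (hK : ContDiffAt ℝ ∞ K (a x)) (hi : (K (a x)).IsInvertible)
    (ha : ContDiffAt ℝ ∞ a x) (hb : ContDiffAt ℝ ∞ b x) (hc : ContDiffAt ℝ ∞ c x) :
    ContDiffAt ℝ ∞ (fun y ↦ christoffel K (a y) (b y) (c y)) x := by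
  have h2 : ContDiffAt ℝ ∞ (fun y ↦ (K (a y)).inverse) x :=
    ContDiffAt.comp x (contDiffAt_inverse_of_isInvertible hi) (ContDiffAt.comp x hK ha)
  have h1 := contDiffAt_fderiv_comp hK ha
  have h3 := contDiffAt_flip_apply (contDiffAt_flip_apply h1 hb) hc
  have h4 : ContDiffAt ℝ ∞ (fun y ↦ fderiv ℝ K (a y) (b y) (c y)) x :=
    (h1.clm_apply hb).clm_apply hc
  have h5 : ContDiffAt ℝ ∞ (fun y ↦ fderiv ℝ K (a y) (c y) (b y)) x :=
    (h1.clm_apply hc).clm_apply hb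
  have h6 := contDiffAt_const (c := (1 / 2 : ℝ)).smul ((h4.add h5).sub h3)
  exact h2.clm_apply h6

theorem contDiffAt_covDerivAlong [CompleteSpace F] {K : F → F →L[ℝ] F →L[ℝ] ℝ}
    {f V : E → F} {u : E → E} {x : E} (hK : ContDiffAt ℝ ∞ K (f x))
    (hi : (K (f x)).IsInvertible) (hf : ContDiffAt ℝ ∞ f x) (hV : ContDiffAt ℝ ∞ V x)
    (hu : ContDiffAt ℝ ∞ u x) :
    ContDiffAt ℝ ∞ (fun y ↦ covDerivAlong K f V y (u y)) x :=
  ((hV.fderiv_right (m := ∞) le_rfl).clm_apply hu).add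
    (contDiffAt_christoffel hK hi hf ((hf.fderiv_right (m := ∞) le_rfl).clm_apply hu) hV)

/-- The trace inserts the vector `(G y).inverse (b^i)`, which moves with `y` but is held constant
inside the covariant derivative. Smoothness of `covDerivAlong` for a fixed field thus does not
suffice; the term is first rewritten through the second derivative of `f`, where both arguments may
vary. -/
theorem contDiffAt_localTension [FiniteDimensional ℝ E] [CompleteSpace F]
    {G : E → E →L[ℝ] E →L[ℝ] ℝ} {K : F → F →L[ℝ] F →L[ℝ] ℝ} {f : E → F} {x : E}
    (hG : ContDiffAt ℝ ∞ G x) (hGi : (G x).IsInvertible)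
    (hK : ContDiffAt ℝ ∞ K (f x)) (hi : (K (f x)).IsInvertible) (hf : ContDiffAt ℝ ∞ f x) :
    ContDiffAt ℝ ∞ (localTension G K f) x := by
  have : CompleteSpace E := FiniteDimensional.complete ℝ E
  have hdf : ContDiffAt ℝ ∞ (fderiv ℝ f) x := hf.fderiv_right (m := ∞) le_rfl
  unfold localTension metricTrace
  refine ContDiffAt.sum fun i _ ↦ ?_
  have hw : ContDiffAt ℝ ∞ (fun y ↦ (G y).inverse
      (LinearMap.toContinuousLinearMap ((Module.finBasis ℝ E).coord i))) x :=
    (ContDiffAt.comp x (contDiffAt_inverse_of_isInvertible hGi) hG).clm_apply contDiffAt_const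
  have hd2 : ContDiffAt ℝ ∞ (fderiv ℝ (fderiv ℝ f)) x := hdf.fderiv_right (m := ∞) le_rfl
  have hdd : ∀ᶠ y in 𝓝 x, DifferentiableAt ℝ (fderiv ℝ f) y := by
    -- `ContDiffAt ℝ ∞` at a point need not persist on a neighbourhood, whereas finite order does;
    -- order 1 is enough here.
    filter_upwards [(hdf.of_le (m := 1) (by exact_mod_cast le_top)).eventually (by simp)] with y hy
    exact hy.differentiableAt (by simp)
  have hmain : ContDiffAt ℝ ∞ (fun y ↦
      fderiv ℝ (fderiv ℝ f) y (Module.finBasis ℝ E i) ((G y).inverse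
          (LinearMap.toContinuousLinearMap ((Module.finBasis ℝ E).coord i))) +
        christoffel K (f y) (fderiv ℝ f y (Module.finBasis ℝ E i)) (fderiv ℝ f y ((G y).inverse
          (LinearMap.toContinuousLinearMap ((Module.finBasis ℝ E).coord i)))) -
        fderiv ℝ f y (christoffel G y (Module.finBasis ℝ E i) ((G y).inverse
          (LinearMap.toContinuousLinearMap ((Module.finBasis ℝ E).coord i))))) x :=
    (((hd2.clm_apply contDiffAt_const).clm_apply hw).add
      (contDiffAt_christoffel hK hi hf (hdf.clm_apply contDiffAt_const)
        (hdf.clm_apply hw))).sub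
    (hdf.clm_apply (contDiffAt_christoffel (a := id) hG hGi contDiffAt_id contDiffAt_const hw))
  refine hmain.congr_of_eventuallyEq ?_
  filter_upwards [hdd] with y hy
  unfold covDerivAlong
  rw [fderiv_clm_apply hy (differentiableAt_const _)]
  simp

/-! ## Naturality under linear maps that intertwine the connections -/

theorem map_metricTrace [FiniteDimensional ℝ E] (P : F →L[ℝ] F') (g : E →L[ℝ] E →L[ℝ] ℝ)
    (T : E → E → F) : P (metricTrace g T) = metricTrace g fun u v ↦ P (T u v) :=
  map_sum _ _ _

theorem map_covDerivAlong {P : F →L[ℝ] F'} {K : F → F →L[ℝ] F →L[ℝ] ℝ}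
    {K' : F' → F' →L[ℝ] F' →L[ℝ] ℝ} {f V : E → F} {x : E}
    (hP : ∀ u v, P (christoffel K (f x) u v) = christoffel K' (P (f x)) (P u) (P v))
    (hf : DifferentiableAt ℝ f x) (hV : DifferentiableAt ℝ V x) (u : E) :
    covDerivAlong K' (fun y ↦ P (f y)) (fun y ↦ P (V y)) x u = P (covDerivAlong K f V x u) := by
  have h (W : E → F) (hW : DifferentiableAt ℝ W x) :
      fderiv ℝ (fun y ↦ P (W y)) x = P.comp (fderiv ℝ W x) :=
    (P.hasFDerivAt.comp x hW.hasFDerivAt).fderiv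
  simp [covDerivAlong, h f hf, h V hV, hP]

theorem covDerivAlong_congr {K : F → F →L[ℝ] F →L[ℝ] ℝ} {f V W : E → F} {x : E}
    (h : V =ᶠ[𝓝 x] W) (u : E) : covDerivAlong K f V x u = covDerivAlong K f W x u := by
  rw [covDerivAlong, covDerivAlong, h.fderiv_eq, h.eq_of_nhds]

/-- Intertwining at the single point `f x` suffices, because the tension does not differentiate the
Christoffel symbols of the target. -/
theorem map_localTension [FiniteDimensional ℝ E] {P : F →L[ℝ] F'}
    {G : E → E →L[ℝ] E →L[ℝ] ℝ} {K : F → F →L[ℝ] F →L[ℝ] ℝ}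
    {K' : F' → F' →L[ℝ] F' →L[ℝ] ℝ} {f : E → F} {x : E}
    (hP : ∀ u v, P (christoffel K (f x) u v) = christoffel K' (P (f x)) (P u) (P v))
    (hf : ContDiffAt ℝ ∞ f x) :
    localTension G K' (fun y ↦ P (f y)) x = P (localTension G K f x) := by
  have hd : ∀ᶠ y in 𝓝 x, fderiv ℝ (fun y ↦ P (f y)) y = P.comp (fderiv ℝ f y) := by
    filter_upwards [(hf.of_le (m := 1) (by exact_mod_cast le_top)).eventually (by simp)] with y hy
    exact (P.hasFDerivAt.comp y (hy.differentiableAt (by simp)).hasFDerivAt).fderiv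
  unfold localTension
  rw [map_metricTrace]
  congr 1
  ext u v
  have hv : (fun y ↦ fderiv ℝ (fun y ↦ P (f y)) y v) =ᶠ[𝓝 x] fun y ↦ P (fderiv ℝ f y v) := by
    filter_upwards [hd] with y hy
    rw [hy, ContinuousLinearMap.comp_apply]
  rw [covDerivAlong_congr hv, map_covDerivAlong hP (hf.differentiableAt (by simp))
    (((hf.fderiv_right (m := ∞) le_rfl).clm_apply contDiffAt_const).differentiableAt (by simp)),
    hd.self_of_nhds, map_sub, ContinuousLinearMap.comp_apply]

/-- Curvature contains first derivatives of the Christoffel symbols, so the intertwining relation is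
needed near `x`. Differentiating it by the chain rule, with `P` outside on one side and inside on
the other, gives the derivative terms. -/
theorem map_curvature [CompleteSpace F] [CompleteSpace F'] {P : F →L[ℝ] F'}
    {K : F → F →L[ℝ] F →L[ℝ] ℝ} {K' : F' → F' →L[ℝ] F' →L[ℝ] ℝ} {x : F}
    (hP : ∀ᶠ z in 𝓝 x, ∀ u v, P (christoffel K z u v) = christoffel K' (P z) (P u) (P v))
    (hK : ContDiffAt ℝ ∞ K x) (hi : (K x).IsInvertible)
    (hK' : ContDiffAt ℝ ∞ K' (P x)) (hi' : (K' (P x)).IsInvertible) (X Y Z : F) :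
    curvature K' (P x) (P X) (P Y) (P Z) = P (curvature K x X Y Z) := by
  have key (A B C : F) : fderiv ℝ (fun y ↦ christoffel K' y (P B) (P C)) (P x) (P A) =
      P (fderiv ℝ (fun y ↦ christoffel K y B C) x A) := by
    have d : DifferentiableAt ℝ (fun y ↦ christoffel K y B C) x :=
      (contDiffAt_christoffel (a := id) hK hi contDiffAt_id contDiffAt_const
        contDiffAt_const).differentiableAt (by simp)
    have d' : DifferentiableAt ℝ (fun y ↦ christoffel K' y (P B) (P C)) (P x) :=
      (contDiffAt_christoffel (a := id) hK' hi' contDiffAt_id contDiffAt_const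
        contDiffAt_const).differentiableAt (by simp)
    have e : (fun z ↦ P (christoffel K z B C)) =ᶠ[𝓝 x]
        fun z ↦ christoffel K' (P z) (P B) (P C) := hP.mono fun z hz ↦ hz B C
    have h1 := (P.hasFDerivAt.comp x d.hasFDerivAt).fderiv
    have h2 := (d'.hasFDerivAt.comp x P.hasFDerivAt).fderiv
    have h3 := (h2.symm.trans e.fderiv_eq.symm).trans h1
    exact DFunLike.congr_fun h3 A
  have hx := hP.self_of_nhds
  simp only [curvature, map_sub, map_add, key, hx]

/-- The tension is itself differentiated, so its naturality and smoothness must hold on a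
neighbourhood of `x`; this is why the hypotheses on `G`, `f` and `K` are eventual ones. -/
theorem map_localBitension [FiniteDimensional ℝ E] [CompleteSpace F] [CompleteSpace F']
    {P : F →L[ℝ] F'} {G : E → E →L[ℝ] E →L[ℝ] ℝ} {K : F → F →L[ℝ] F →L[ℝ] ℝ}
    {K' : F' → F' →L[ℝ] F' →L[ℝ] ℝ} {f : E → F} {x : E}
    (hG : ∀ᶠ y in 𝓝 x, ContDiffAt ℝ ∞ G y ∧ (G y).IsInvertible)
    (hf : ∀ᶠ y in 𝓝 x, ContDiffAt ℝ ∞ f y)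
    (hK : ∀ᶠ z in 𝓝 (f x), ContDiffAt ℝ ∞ K z ∧ (K z).IsInvertible)
    (hK' : ContDiffAt ℝ ∞ K' (P (f x))) (hi' : (K' (P (f x))).IsInvertible)
    (hP : ∀ᶠ z in 𝓝 (f x), ∀ u v,
      P (christoffel K z u v) = christoffel K' (P z) (P u) (P v)) :
    localBitension G K' (fun y ↦ P (f y)) x = P (localBitension G K f x) := by
  have hfx := hf.self_of_nhds
  have hτs : ∀ᶠ y in 𝓝 x, ContDiffAt ℝ ∞ (localTension G K f) y := by
    filter_upwards [hG, hf, hfx.continuousAt.eventually hK] with y h1 h2 h3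
    exact contDiffAt_localTension h1.1 h1.2 h3.1 h3.2 h2
  have hτ : localTension G K' (fun y ↦ P (f y)) =ᶠ[𝓝 x] fun y ↦ P (localTension G K f y) := by
    filter_upwards [hf, hfx.continuousAt.eventually hP] with y h1 h2
    exact map_localTension h2 h1
  have hdτ (v : E) : (fun y ↦ covDerivAlong K' (fun y ↦ P (f y))
      (localTension G K' (fun y ↦ P (f y))) y v) =ᶠ[𝓝 x]
      fun y ↦ P (covDerivAlong K f (localTension G K f) y v) := by
    filter_upwards [hτ.eventuallyEq_nhds, hτs, hf, hfx.continuousAt.eventually hP]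
      with y h1 h2 h3 h4
    rw [covDerivAlong_congr h1, map_covDerivAlong h4 (h3.differentiableAt (by simp))
      (h2.differentiableAt (by simp))]
  have hPx := hP.self_of_nhds
  have hKx := hK.self_of_nhds
  have hdf : fderiv ℝ (fun y ↦ P (f y)) x = P.comp (fderiv ℝ f x) :=
    (P.hasFDerivAt.comp x (hfx.differentiableAt (by simp)).hasFDerivAt).fderiv
  unfold localBitension
  rw [map_sub, map_metricTrace, map_metricTrace]
  congr 2
  · ext u v
    rw [map_sub, covDerivAlong_congr (hdτ v), map_covDerivAlong hPx
      (hfx.differentiableAt (by simp)) ((contDiffAt_covDerivAlong hKx.1 hKx.2 hfx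
        hτs.self_of_nhds contDiffAt_const).differentiableAt (by simp)),
      (hdτ _).eq_of_nhds]
  · ext u v
    rw [hdf, hτ.eq_of_nhds, ContinuousLinearMap.comp_apply, ContinuousLinearMap.comp_apply,
      map_curvature hP hKx.1 hKx.2 hK' hi']

/-! ## Vanishing tension -/

theorem christoffel_zero_left (K : F → F →L[ℝ] F →L[ℝ] ℝ) (x v : F) :
    christoffel K x 0 v = 0 := by
  simp [christoffel]

theorem christoffel_zero_right (K : F → F →L[ℝ] F →L[ℝ] ℝ) (x u : F) :
    christoffel K x u 0 = 0 := by
  simp [christoffel]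

theorem localBitension_eq_zero [FiniteDimensional ℝ E] {G : E → E →L[ℝ] E →L[ℝ] ℝ}
    {K : F → F →L[ℝ] F →L[ℝ] ℝ} {f : E → F} {x : E}
    (h : localTension G K f =ᶠ[𝓝 x] fun _ ↦ 0) : localBitension G K f x = 0 := by
  have h0 (y u : E) : covDerivAlong K f (fun _ ↦ 0) y u = 0 := by
    simp [covDerivAlong, christoffel_zero_right]
  have h1 (v : E) : (fun y ↦ covDerivAlong K f (localTension G K f) y v) =ᶠ[𝓝 x]
      fun _ ↦ 0 := by
    -- Two covariant derivatives are taken, so the first must vanish near `x` and not only at `x`.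
    filter_upwards [h.eventuallyEq_nhds] with y hy
    rw [covDerivAlong_congr hy, h0]
  have h2 (u : E) : covDerivAlong K f (localTension G K f) x u = 0 := (h1 u).eq_of_nhds
  simp [localBitension, metricTrace, covDerivAlong_congr (h1 _), h0, h2, h.eq_of_nhds, curvature,
    christoffel_zero_left, christoffel_zero_right]

/-! ## The connection of a product metric -/

/-- Uniqueness in Koszul's formula: an invertible form determines a vector from its pairings. -/
theorem christoffel_eq_of_forall {K : F → F →L[ℝ] F →L[ℝ] ℝ} {x u v w : F}
    (hi : (K x).IsInvertible)
    (h : ∀ z, 2 * K x w z = fderiv ℝ K x u v z + fderiv ℝ K x v u z - fderiv ℝ K x z u v) :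
    christoffel K x u v = w := by
  unfold christoffel
  rw [← hi.inverse_apply_eq (y := K x w) |>.2 rfl]
  congr 1
  ext z
  simp [← h z]

theorem two_mul_christoffel {K : F → F →L[ℝ] F →L[ℝ] ℝ} {x : F} (hi : (K x).IsInvertible)
    (u v z : F) : 2 * K x (christoffel K x u v) z =
      fderiv ℝ K x u v z + fderiv ℝ K x v u z - fderiv ℝ K x z u v := by
  have h : K x (christoffel K x u v) = _ := (hi.inverse_apply_eq.1 rfl).symm
  rw [h]
  simp

theorem fderiv_form_apply {K : F → F →L[ℝ] F →L[ℝ] ℝ} {x : F} (hK : DifferentiableAt ℝ K x)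
    (u a b : F) : fderiv ℝ (fun z ↦ K z a b) x u = fderiv ℝ K x u a b := by
  have h := (hK.hasFDerivAt.clm_apply (hasFDerivAt_const a x)).clm_apply (hasFDerivAt_const b x)
  rw [h.fderiv]
  simp

/-- A block has no derivative in the other factor's variable, so the Koszul expression is the sum of
those of the blocks, and the pair of Christoffel vectors satisfies the characterization of
`christoffel_eq_of_forall`. -/
theorem christoffel_prod {K : F × F' → (F × F') →L[ℝ] (F × F') →L[ℝ] ℝ}
    {K₁ : F → F →L[ℝ] F →L[ℝ] ℝ} {K₂ : F' → F' →L[ℝ] F' →L[ℝ] ℝ} {x : F × F'}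
    (h : ∀ᶠ z in 𝓝 x, ∀ a b, K z a b = K₁ z.1 a.1 b.1 + K₂ z.2 a.2 b.2)
    (hK : DifferentiableAt ℝ K x) (hi : (K x).IsInvertible)
    (hK₁ : DifferentiableAt ℝ K₁ x.1) (hi₁ : (K₁ x.1).IsInvertible)
    (hK₂ : DifferentiableAt ℝ K₂ x.2) (hi₂ : (K₂ x.2).IsInvertible) (u v : F × F') :
    christoffel K x u v = (christoffel K₁ x.1 u.1 v.1, christoffel K₂ x.2 u.2 v.2) := by
  have hD (w a b : F × F') : fderiv ℝ K x w a b =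
      fderiv ℝ K₁ x.1 w.1 a.1 b.1 + fderiv ℝ K₂ x.2 w.2 a.2 b.2 := by
    have e : (fun z ↦ K z a b) =ᶠ[𝓝 x] fun z ↦ K₁ z.1 a.1 b.1 + K₂ z.2 a.2 b.2 :=
      h.mono fun z hz ↦ hz a b
    have d₁ : DifferentiableAt ℝ (fun z ↦ K₁ z a.1 b.1) x.1 :=
      (hK₁.clm_apply (differentiableAt_const _)).clm_apply (differentiableAt_const _)
    have d₂ : DifferentiableAt ℝ (fun z ↦ K₂ z a.2 b.2) x.2 :=
      (hK₂.clm_apply (differentiableAt_const _)).clm_apply (differentiableAt_const _)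
    have d := (d₁.hasFDerivAt.comp x hasFDerivAt_fst).add (d₂.hasFDerivAt.comp x hasFDerivAt_snd)
    rw [← fderiv_form_apply hK, e.fderiv_eq, ← fderiv_form_apply hK₁, ← fderiv_form_apply hK₂]
    exact DFunLike.congr_fun d.fderiv w
  refine christoffel_eq_of_forall hi fun z ↦ ?_
  rw [h.self_of_nhds, mul_add, two_mul_christoffel hi₁, two_mul_christoffel hi₂, hD, hD, hD]
  ring

end LocalCalculus


/-! ### Smooth sections read in a fixed trivialization -/

theorem contMDiffAt_section_trivializationAt {𝕜 : Type*} [NontriviallyNormedField 𝕜]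
    {EB : Type*} [NormedAddCommGroup EB] [NormedSpace 𝕜 EB] {HB : Type*} [TopologicalSpace HB]
    {IB : ModelWithCorners 𝕜 EB HB} {B : Type*} [TopologicalSpace B] [ChartedSpace HB B]
    {V : Type*} [NormedAddCommGroup V] [NormedSpace 𝕜 V] {Z : B → Type*}
    [∀ x, AddCommMonoid (Z x)] [∀ x, Module 𝕜 (Z x)] [TopologicalSpace (TotalSpace V Z)]
    [∀ x, TopologicalSpace (Z x)] [FiberBundle V Z] [VectorBundle 𝕜 V Z] {n : WithTop ℕ∞}
    [ContMDiffVectorBundle n V Z IB] {s : ∀ x, Z x} {x₀ x : B}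
    (hs : ContMDiff IB (IB.prod 𝓘(𝕜, V)) n fun x ↦ TotalSpace.mk' V x (s x))
    (hx : x ∈ (trivializationAt V Z x₀).baseSet) :
    ContMDiffAt IB 𝓘(𝕜, V) n (fun x ↦ (trivializationAt V Z x₀ ⟨x, s x⟩).2) x :=
  (Trivialization.contMDiffAt_section_iff _ hx).1 (hs x)

section Written

variable
  {E : Type*} [NormedAddCommGroup E] [NormedSpace ℝ E]
  {H : Type*} [TopologicalSpace H] {I : ModelWithCorners ℝ E H}
  {M : Type*} [TopologicalSpace M] [ChartedSpace H M]
  {F₁ : Type*} [NormedAddCommGroup F₁] [NormedSpace ℝ F₁]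
  {H₁ : Type*} [TopologicalSpace H₁] {J₁ : ModelWithCorners ℝ F₁ H₁}
  {N₁ : Type*} [TopologicalSpace N₁] [ChartedSpace H₁ N₁]
  {F₂ : Type*} [NormedAddCommGroup F₂] [NormedSpace ℝ F₂]
  {H₂ : Type*} [TopologicalSpace H₂] {J₂ : ModelWithCorners ℝ F₂ H₂}
  {N₂ : Type*} [TopologicalSpace N₂] [ChartedSpace H₂ N₂]

/-! ## Maps in charts -/

theorem writtenInExtChartAt_prodMk (φ : M → N₁) (ψ : M → N₂) (x₀ : M) (y : E) :
    writtenInExtChartAt I (J₁.prod J₂) x₀ (fun x ↦ (φ x, ψ x)) y =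
      (writtenInExtChartAt I J₁ x₀ φ y, writtenInExtChartAt I J₂ x₀ ψ y) := by
  simp [writtenInExtChartAt]

theorem eventually_mem_source {φ : M → N₁} (hφ : Continuous φ) (x₀ : M) :
    ∀ᶠ y in 𝓝 (extChartAt I x₀ x₀),
      φ ((extChartAt I x₀).symm y) ∈ (extChartAt J₁ (φ x₀)).source := by
  have h : ContinuousAt (fun y ↦ φ ((extChartAt I x₀).symm y)) (extChartAt I x₀ x₀) :=
    hφ.continuousAt.comp (continuousAt_extChartAt_symm x₀)
  exact h.eventually ((isOpen_extChartAt_source (φ x₀)).mem_nhds (by simp))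

theorem eventually_mem_target {φ : M → N₁} (hφ : Continuous φ) (x₀ : M) :
    ∀ᶠ y in 𝓝 (extChartAt I x₀ x₀),
      writtenInExtChartAt I J₁ x₀ φ y ∈ (extChartAt J₁ (φ x₀)).target :=
  (eventually_mem_source hφ x₀).mono fun _ hy ↦ (extChartAt J₁ (φ x₀)).map_source hy

end Written

section Chart

variable
  {E : Type*} [NormedAddCommGroup E] [NormedSpace ℝ E]
  {H : Type*} [TopologicalSpace H] {I : ModelWithCorners ℝ E H}
  {M : Type*} [TopologicalSpace M] [ChartedSpace H M] [IsManifold I ∞ M]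
  {F : Type*} [NormedAddCommGroup F] [NormedSpace ℝ F]
  {H' : Type*} [TopologicalSpace H'] {J : ModelWithCorners ℝ F H'}
  {N : Type*} [TopologicalSpace N] [ChartedSpace H' N] [IsManifold J ∞ N]

/-! ## Metrics in charts -/

/-- Positivity makes `B` injective into the dual, and equality of dimensions makes it bijective. -/
theorem isInvertible_of_pos [FiniteDimensional ℝ E] {B : E →L[ℝ] E →L[ℝ] ℝ} (hB : ∀ v, v ≠ 0 → 0 < B v v) :
    B.IsInvertible := by
  have hinj : Function.Injective (LinearMap.toContinuousLinearMap.symm.toLinearMap ∘ₗ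
      B.toLinearMap : E →ₗ[ℝ] (E →ₗ[ℝ] ℝ)) := by
    rw [injective_iff_map_eq_zero]
    intro v hv
    by_contra h
    have h0 : B v v = 0 := DFunLike.congr_fun hv v
    exact (hB v h).ne' h0
  have hd : Module.finrank ℝ E = Module.finrank ℝ (E →ₗ[ℝ] ℝ) :=
    (Subspace.dual_finrank_eq (K := ℝ) (V := E)).symm
  let e := (LinearEquiv.ofInjectiveOfFinrankEq _ hinj hd).trans LinearMap.toContinuousLinearMap
  refine ⟨e.toContinuousLinearEquiv, ?_⟩
  ext v w
  rfl

theorem isInvertible_chartMetric [FiniteDimensional ℝ E]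
    (g : ContMDiffRiemannianMetric I ∞ E (TangentSpace I : M → Type _)) (x₀ : M) {y : E}
    (hy : y ∈ (extChartAt I x₀).target) : (chartMetric g x₀ y).IsInvertible := by
  refine isInvertible_of_pos fun v hv ↦ ?_
  refine g.pos _ _ fun h ↦ hv ?_
  obtain ⟨e, he⟩ := isInvertible_mfderivWithin_extChartAt_symm hy
  rw [← he] at h
  exact (map_eq_zero_iff e e.injective).1 h

theorem contMDiffAt_trivializationAt_inner
    (g : ContMDiffRiemannianMetric I ∞ E (TangentSpace I : M → Type _)) (x₀ : M) {x : M}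
    (hx : x ∈ (chartAt H x₀).source) :
    ContMDiffAt I 𝓘(ℝ, E →L[ℝ] E →L[ℝ] ℝ) ∞
      (fun x : M ↦ (trivializationAt (E →L[ℝ] E →L[ℝ] ℝ)
        (fun x : M ↦ TangentSpace I x →L[ℝ] TangentSpace I x →L[ℝ] ℝ) x₀ ⟨x, g.inner x⟩).2) x := by
  have i1 (x : M) : ContinuousAdd (TangentSpace I x →L[ℝ] ℝ) :=
    inferInstanceAs (ContinuousAdd (E →L[ℝ] ℝ))
  have i2 (x : M) : IsTopologicalAddGroup (TangentSpace I x →L[ℝ] ℝ) :=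
    inferInstanceAs (IsTopologicalAddGroup (E →L[ℝ] ℝ))
  have i3 (x : M) : ContinuousSMul ℝ (TangentSpace I x →L[ℝ] ℝ) :=
    inferInstanceAs (ContinuousSMul ℝ (E →L[ℝ] ℝ))
  refine contMDiffAt_section_trivializationAt (x₀ := x₀) (x := x) g.contMDiff ?_
  -- The base set for bilinear forms is an intersection: one tangent base set per argument, and the
  -- whole base for the trivial bundle of values.
  exact ⟨hx, hx, trivial⟩

/-- On the chart target, `chartMetric` is the smooth section `g.inner` read in the trivialization at
`x₀`, composed with the inverse chart. -/
theorem contDiffAt_chartMetric [I.Boundaryless]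
    (g : ContMDiffRiemannianMetric I ∞ E (TangentSpace I : M → Type _)) (x₀ : M) {y : E}
    (hy : y ∈ (extChartAt I x₀).target) : ContDiffAt ℝ ∞ (chartMetric g x₀) y := by
  have hs : (extChartAt I x₀).symm y ∈ (chartAt H x₀).source := by
    simpa using (extChartAt I x₀).map_target hy
  have h1 := contMDiffAt_trivializationAt_inner g x₀ hs
  have h2 : ContMDiffAt 𝓘(ℝ, E) I ∞ (extChartAt I x₀).symm y :=
    (contMDiffOn_extChartAt_symm x₀).contMDiffAt ((isOpen_extChartAt_target x₀).mem_nhds hy)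
  have h3 := (ContMDiffAt.comp y h1 h2).contDiffAt
  refine h3.congr_of_eventuallyEq ?_
  filter_upwards [(isOpen_extChartAt_target x₀).mem_nhds hy] with z hz
  have hzs : (extChartAt I x₀).symm z ∈ (chartAt H x₀).source := by
    simpa using (extChartAt I x₀).map_target hz
  refine ContinuousLinearMap.ext fun u ↦ ContinuousLinearMap.ext fun v ↦ ?_
  have h4 := trivializationAt_form_apply x₀ _ hzs (g.inner ((extChartAt I x₀).symm z)) u v
  rw [(extChartAt I x₀).right_inv hz] at h4
  exact h4.symm

theorem contDiffAt_writtenInExtChartAt [I.Boundaryless] {φ : M → N} (hφ : ContMDiff I J ∞ φ) (x₀ : M) :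
    ∀ᶠ y in 𝓝 (extChartAt I x₀ x₀), ContDiffAt ℝ ∞ (writtenInExtChartAt I J x₀ φ) y := by
  have h := (contMDiff_iff.1 hφ).2 x₀ (φ x₀)
  have hs := eventually_mem_source (I := I) (J₁ := J) hφ.continuous x₀
  -- `contMDiff_iff` gives smoothness on a set; it becomes smoothness at `y` where that set is a
  -- neighbourhood of `y`, hence for all `y` near the base point.
  filter_upwards [eventually_mem_nhds_iff.2 (Filter.inter_mem (extChartAt_target_mem_nhds x₀) hs)]
    with y hy
  exact h.contDiffAt hy

theorem eventually_chartMetric [FiniteDimensional ℝ E] [I.Boundaryless]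
    (g : ContMDiffRiemannianMetric I ∞ E (TangentSpace I : M → Type _))
    (x₀ : M) : ∀ᶠ y in 𝓝 (extChartAt I x₀ x₀),
      ContDiffAt ℝ ∞ (chartMetric g x₀) y ∧ (chartMetric g x₀ y).IsInvertible := by
  filter_upwards [extChartAt_target_mem_nhds x₀] with y hy
  exact ⟨contDiffAt_chartMetric g x₀ hy, isInvertible_chartMetric g x₀ hy⟩

theorem IsHarmonic.isBiharmonic [FiniteDimensional ℝ E]
    {g : ContMDiffRiemannianMetric I ∞ E (TangentSpace I : M → Type _)}
    {h : ContMDiffRiemannianMetric J ∞ F (TangentSpace J : N → Type _)} {φ : M → N}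
    (hφ : IsHarmonic g h φ) : IsBiharmonic g h φ := fun x₀ ↦ by
  filter_upwards [(hφ x₀).eventually_nhds] with y hy
  exact localBitension_eq_zero hy

end Chart

section Product

variable
  {E : Type*} [NormedAddCommGroup E] [NormedSpace ℝ E] [FiniteDimensional ℝ E]
  {H : Type*} [TopologicalSpace H] {I : ModelWithCorners ℝ E H} [I.Boundaryless]
  {M : Type*} [TopologicalSpace M] [ChartedSpace H M] [IsManifold I ∞ M]
  {F₁ : Type*} [NormedAddCommGroup F₁] [NormedSpace ℝ F₁]
  {H₁ : Type*} [TopologicalSpace H₁] {J₁ : ModelWithCorners ℝ F₁ H₁} [J₁.Boundaryless]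
  {N₁ : Type*} [TopologicalSpace N₁] [ChartedSpace H₁ N₁] [IsManifold J₁ ∞ N₁]
  {F₂ : Type*} [NormedAddCommGroup F₂] [NormedSpace ℝ F₂]
  {H₂ : Type*} [TopologicalSpace H₂] {J₂ : ModelWithCorners ℝ F₂ H₂} [J₂.Boundaryless]
  {N₂ : Type*} [TopologicalSpace N₂] [ChartedSpace H₂ N₂] [IsManifold J₂ ∞ N₂]
  {g : ContMDiffRiemannianMetric I ∞ E (TangentSpace I : M → Type _)}
  {h₁ : ContMDiffRiemannianMetric J₁ ∞ F₁ (TangentSpace J₁ : N₁ → Type _)}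
  {h₂ : ContMDiffRiemannianMetric J₂ ∞ F₂ (TangentSpace J₂ : N₂ → Type _)}
  {φ : M → N₁} {ψ : M → N₂}

/-! ## Maps into a Riemannian product -/

/-- The inverse product chart is the product of the inverse charts, so its derivative acts
componentwise. -/
theorem chartMetric_prodMetric_apply (p₀ : N₁ × N₂) {z : F₁ × F₂}
    (hz : z ∈ (extChartAt (J₁.prod J₂) p₀).target) (a b : F₁ × F₂) :
    chartMetric (prodMetric h₁ h₂) p₀ z a b =
      chartMetric h₁ p₀.1 z.1 a.1 b.1 + chartMetric h₂ p₀.2 z.2 a.2 b.2 := by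
  have hz' := hz
  rw [extChartAt_prod] at hz'
  have hD (w : F₁ × F₂) :
      mfderivWithin 𝓘(ℝ, F₁ × F₂) (J₁.prod J₂) (extChartAt (J₁.prod J₂) p₀).symm
        (Set.range (J₁.prod J₂)) z w =
      ((mfderivWithin 𝓘(ℝ, F₁) J₁ (extChartAt J₁ p₀.1).symm (Set.range J₁) z.1 w.1,
        mfderivWithin 𝓘(ℝ, F₂) J₂ (extChartAt J₂ p₀.2).symm (Set.range J₂) z.2 w.2) :
          F₁ × F₂) := by
    have u₁ : UniqueMDiffWithinAt 𝓘(ℝ, F₁) (Set.range J₁) z.1 := by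
      rw [J₁.range_eq_univ]; exact uniqueMDiffWithinAt_univ _
    have u₂ : UniqueMDiffWithinAt 𝓘(ℝ, F₂) (Set.range J₂) z.2 := by
      rw [J₂.range_eq_univ]; exact uniqueMDiffWithinAt_univ _
    have key := mfderivWithin_prodMap (p := z)
      (mdifferentiableWithinAt_extChartAt_symm (I := J₁) hz'.1)
      (mdifferentiableWithinAt_extChartAt_symm (I := J₂) hz'.2) u₁ u₂
    have hr : Set.range (J₁.prod J₂) = Set.range J₁ ×ˢ Set.range J₂ := by
      rw [← Set.range_prodMap]; rfl
    have he : ((extChartAt (J₁.prod J₂) p₀).symm : F₁ × F₂ → N₁ × N₂) =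
        Prod.map (extChartAt J₁ p₀.1).symm (extChartAt J₂ p₀.2).symm := by
      rw [extChartAt_prod]; rfl
    rw [hr, he]
    rw [← modelWithCornersSelf_prod, chartedSpaceSelf_prod] at key
    exact DFunLike.congr_fun key w
  have hs : (extChartAt (J₁.prod J₂) p₀).symm z =
      ((extChartAt J₁ p₀.1).symm z.1, (extChartAt J₂ p₀.2).symm z.2) := by
    rw [extChartAt_prod]; rfl
  have h := prodInner_apply h₁ h₂ ((extChartAt (J₁.prod J₂) p₀).symm z)
    (mfderivWithin 𝓘(ℝ, F₁ × F₂) (J₁.prod J₂) (extChartAt (J₁.prod J₂) p₀).symm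
        (Set.range (J₁.prod J₂)) z a)
    (mfderivWithin 𝓘(ℝ, F₁ × F₂) (J₁.prod J₂) (extChartAt (J₁.prod J₂) p₀).symm
        (Set.range (J₁.prod J₂)) z b)
  refine h.trans ?_
  rw [hD, hD, hs]
  rfl

theorem christoffel_chartMetric_prodMetric [FiniteDimensional ℝ F₁] [FiniteDimensional ℝ F₂]
    (p₀ : N₁ × N₂) {z : F₁ × F₂}
    (hz : z ∈ (extChartAt (J₁.prod J₂) p₀).target) (u v : F₁ × F₂) :
    christoffel (chartMetric (prodMetric h₁ h₂) p₀) z u v =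
      (christoffel (chartMetric h₁ p₀.1) z.1 u.1 v.1,
        christoffel (chartMetric h₂ p₀.2) z.2 u.2 v.2) := by
  have hz' := hz
  rw [extChartAt_prod] at hz'
  refine christoffel_prod ?_ ((contDiffAt_chartMetric _ _ hz).differentiableAt (by simp))
    (isInvertible_chartMetric _ _ hz)
    ((contDiffAt_chartMetric h₁ _ hz'.1).differentiableAt (by simp))
    (isInvertible_chartMetric _ _ hz'.1)
    ((contDiffAt_chartMetric h₂ _ hz'.2).differentiableAt (by simp))
    (isInvertible_chartMetric _ _ hz'.2) u v
  filter_upwards [(isOpen_extChartAt_target p₀).mem_nhds hz] with w hw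
  exact chartMetric_prodMetric_apply p₀ hw

theorem eventually_tensionInChart_prodMk [FiniteDimensional ℝ F₁] [FiniteDimensional ℝ F₂]
    (hφ : ContMDiff I J₁ ∞ φ) (hψ : ContMDiff I J₂ ∞ ψ)
    (x₀ : M) : ∀ᶠ y in 𝓝 (extChartAt I x₀ x₀),
      tensionInChart g (prodMetric h₁ h₂) (fun x ↦ (φ x, ψ x)) x₀ y =
        (tensionInChart g h₁ φ x₀ y, tensionInChart g h₂ ψ x₀ y) := by
  have hχ := hφ.prodMk hψ
  filter_upwards [contDiffAt_writtenInExtChartAt hχ x₀,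
    eventually_mem_target (J₁ := J₁.prod J₂) hχ.continuous x₀] with y hy hz
  -- Projecting the chart expression of the pair gives the chart expression of each factor, which
  -- identifies the left side of `map_localTension`.
  have hw := funext (writtenInExtChartAt_prodMk (I := I) (J₁ := J₁) (J₂ := J₂) φ ψ x₀)
  refine Prod.ext ?_ ?_
  · refine (map_localTension (P := ContinuousLinearMap.fst ℝ F₁ F₂)
      (K' := chartMetric h₁ (φ x₀)) (fun u v ↦ ?_) hy).symm.trans ?_
    · rw [christoffel_chartMetric_prodMetric _ hz]
      rfl
    · rw [hw]
      rfl
  · refine (map_localTension (P := ContinuousLinearMap.snd ℝ F₁ F₂)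
      (K' := chartMetric h₂ (ψ x₀)) (fun u v ↦ ?_) hy).symm.trans ?_
    · rw [christoffel_chartMetric_prodMetric _ hz]
      rfl
    · rw [hw]
      rfl

theorem eventually_bitensionInChart_prodMk [FiniteDimensional ℝ F₁] [FiniteDimensional ℝ F₂]
    (hφ : ContMDiff I J₁ ∞ φ) (hψ : ContMDiff I J₂ ∞ ψ)
    (x₀ : M) : ∀ᶠ y in 𝓝 (extChartAt I x₀ x₀),
      bitensionInChart g (prodMetric h₁ h₂) (fun x ↦ (φ x, ψ x)) x₀ y =
        (bitensionInChart g h₁ φ x₀ y, bitensionInChart g h₂ ψ x₀ y) := by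
  have hχ := hφ.prodMk hψ
  filter_upwards [(contDiffAt_writtenInExtChartAt hχ x₀).eventually_nhds,
    (eventually_chartMetric g x₀).eventually_nhds,
    eventually_mem_target (J₁ := J₁.prod J₂) hχ.continuous x₀] with y hy hg hz
  have hw := funext (writtenInExtChartAt_prodMk (I := I) (J₁ := J₁) (J₂ := J₂) φ ψ x₀)
  have hn := (isOpen_extChartAt_target (I := J₁.prod J₂) (φ x₀, ψ x₀)).mem_nhds hz
  have hz' := hz
  rw [extChartAt_prod] at hz'
  have hK : ∀ᶠ z in 𝓝 (writtenInExtChartAt I (J₁.prod J₂) x₀ (fun x ↦ (φ x, ψ x)) y),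
      ContDiffAt ℝ ∞ (chartMetric (prodMetric h₁ h₂) (φ x₀, ψ x₀)) z ∧
        (chartMetric (prodMetric h₁ h₂) (φ x₀, ψ x₀) z).IsInvertible := by
    filter_upwards [hn] with z hz
    exact ⟨contDiffAt_chartMetric _ _ hz, isInvertible_chartMetric _ _ hz⟩
  have hc := Filter.mem_of_superset hn fun z hz ↦
    christoffel_chartMetric_prodMetric (h₁ := h₁) (h₂ := h₂) _ hz
  have : CompleteSpace F₁ := FiniteDimensional.complete ℝ F₁
  have : CompleteSpace F₂ := FiniteDimensional.complete ℝ F₂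
  refine Prod.ext ?_ ?_
  · refine (map_localBitension (P := ContinuousLinearMap.fst ℝ F₁ F₂) (K' := chartMetric h₁ (φ x₀))
      hg hy hK (contDiffAt_chartMetric _ _ hz'.1) (isInvertible_chartMetric _ _ hz'.1)
      ?_).symm.trans ?_
    · exact Filter.mem_of_superset hc fun z hz u v ↦ congrArg Prod.fst (hz u v)
    · rw [hw]
      rfl
  · refine (map_localBitension (P := ContinuousLinearMap.snd ℝ F₁ F₂) (K' := chartMetric h₂ (ψ x₀))
      hg hy hK (contDiffAt_chartMetric _ _ hz'.2) (isInvertible_chartMetric _ _ hz'.2)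
      ?_).symm.trans ?_
    · exact Filter.mem_of_superset hc fun z hz u v ↦ congrArg Prod.snd (hz u v)
    · rw [hw]
      rfl

/-! ### Componentwise criteria and the main theorem -/

theorem isHarmonic_prodMk_iff [FiniteDimensional ℝ F₁] [FiniteDimensional ℝ F₂]
    (hφ : ContMDiff I J₁ ∞ φ) (hψ : ContMDiff I J₂ ∞ ψ) :
    IsHarmonic g (prodMetric h₁ h₂) (fun x ↦ (φ x, ψ x)) ↔
      IsHarmonic g h₁ φ ∧ IsHarmonic g h₂ ψ := by
  simp only [IsHarmonic, ← forall_and, ← Filter.eventually_and]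
  refine forall_congr' fun x₀ ↦ Filter.eventually_congr ?_
  filter_upwards [eventually_tensionInChart_prodMk hφ hψ x₀] with y hy
  rw [hy, Prod.mk_eq_zero]

theorem isBiharmonic_prodMk_iff [FiniteDimensional ℝ F₁] [FiniteDimensional ℝ F₂]
    (hφ : ContMDiff I J₁ ∞ φ) (hψ : ContMDiff I J₂ ∞ ψ) :
    IsBiharmonic g (prodMetric h₁ h₂) (fun x ↦ (φ x, ψ x)) ↔
      IsBiharmonic g h₁ φ ∧ IsBiharmonic g h₂ ψ := by
  simp only [IsBiharmonic, ← forall_and, ← Filter.eventually_and]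
  refine forall_congr' fun x₀ ↦ Filter.eventually_congr ?_
  filter_upwards [eventually_bitensionInChart_prodMk hφ hψ x₀] with y hy
  rw [hy, Prod.mk_eq_zero]

end Product

end BiharmonicMaps

end
open BiharmonicMaps in
theorem theorem3p3
    {E : Type*} [NormedAddCommGroup E] [NormedSpace ℝ E] [FiniteDimensional ℝ E]
    {H : Type*} [TopologicalSpace H] {I : ModelWithCorners ℝ E H} [I.Boundaryless]
    {M : Type*} [TopologicalSpace M] [ChartedSpace H M] [IsManifold I ∞ M]
    {F₁ : Type*} [NormedAddCommGroup F₁] [NormedSpace ℝ F₁] [FiniteDimensional ℝ F₁]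
    {H₁ : Type*} [TopologicalSpace H₁] {J₁ : ModelWithCorners ℝ F₁ H₁} [J₁.Boundaryless]
    {N₁ : Type*} [TopologicalSpace N₁] [ChartedSpace H₁ N₁] [IsManifold J₁ ∞ N₁]
    {F₂ : Type*} [NormedAddCommGroup F₂] [NormedSpace ℝ F₂] [FiniteDimensional ℝ F₂]
    {H₂ : Type*} [TopologicalSpace H₂] {J₂ : ModelWithCorners ℝ F₂ H₂} [J₂.Boundaryless]
    {N₂ : Type*} [TopologicalSpace N₂] [ChartedSpace H₂ N₂] [IsManifold J₂ ∞ N₂]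
    (g : Bundle.ContMDiffRiemannianMetric I ∞ E (TangentSpace I : M → Type _))
    (h₁ : Bundle.ContMDiffRiemannianMetric J₁ ∞ F₁ (TangentSpace J₁ : N₁ → Type _))
    (h₂ : Bundle.ContMDiffRiemannianMetric J₂ ∞ F₂ (TangentSpace J₂ : N₂ → Type _))
    (φ : M → N₁) (hφ : ContMDiff I J₁ ∞ φ) (ψ : M → N₂) (hψ : ContMDiff I J₂ ∞ ψ) :
    (IsBiharmonic g (prodMetric h₁ h₂) (fun x ↦ (φ x, ψ x)) ↔
      IsBiharmonic g h₁ φ ∧ IsBiharmonic g h₂ ψ) ∧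
    ((IsHarmonic g h₁ φ ∧ IsProperBiharmonic g h₂ ψ) ∨
        (IsProperBiharmonic g h₁ φ ∧ IsHarmonic g h₂ ψ) →
      IsProperBiharmonic g (prodMetric h₁ h₂) (fun x ↦ (φ x, ψ x))) := by
  have hb := isBiharmonic_prodMk_iff (g := g) (h₁ := h₁) (h₂ := h₂) hφ hψ
  have hh := isHarmonic_prodMk_iff (g := g) (h₁ := h₁) (h₂ := h₂) hφ hψ
  refine ⟨hb, ?_⟩
  rintro (⟨h, hp, hn⟩ | ⟨⟨hp, hn⟩, h⟩)
  · exact ⟨hb.2 ⟨h.isBiharmonic, hp⟩, fun hc ↦ hn (hh.1 hc).2⟩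
  · exact ⟨hb.2 ⟨hp, h.isBiharmonic⟩, fun hc ↦ hn (hh.1 hc).1⟩
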